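/- Let $G$ be a Hausdorff topological group acting continuously on a compact Hausdorff space $X$ such that every $G$-orbit is dense in $X$ (i.e. $(G,X)$ is minimal), and let $d\ge 1$ and $x\in X$. Write $X^{[d]}=X^{\{0,1\}^d}$ and $G^{[d]}=G^{\{0,1\}^d}$, the latter acting coordinatewise on $X^{[d]}$, and let $x^{[d]}\in X^{[d]}$ be the constant configuration with value $x$. For $F\subset\{0,1\}^d$ and $h\in G$ let $[h]_F\in G^{[d]}$ be equal to $h$ on $F$ and to the identity off $F$. The Host--Kra cube group $\mathcal{HK}^{[d]}\le G^{[d]}$ is generated by all $[h]_F$ with $h\in G$ and $F=\{\omega:\omega_i=a\}$, $1\le i\le d$, $a\in\{0,1\}$; the face group $\mathcal F^{[d]}$ is generated by those with $a=1$. Put $$C_G^{[d]}(X)=\overline{\{g\,y^{[d]}: g\in\mathcal{HK}^{[d]},\ y\in X\}},\quad C_x^{[d]}(X)=\{c\in C_G^{[d]}(X): c(\vec 0)=x\},\quad Y_x^{[d]}(X)=\overline{\mathcal F^{[d]}x^{[d]}} .$$ Let $\pi_*:X^{[d]}\to X^{\{0,1\}^d\setminus\{\vec 0\}}$ forget the $\vec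 0$-coordinate, let $\mathcal F^{[d]}$ act coordinatewise on $X^{\{0,1\}^d\setminus\{\vec 0\}}$, and put $C_{x*}^{[d]}(X)=\pi_*(C_x^{[d]}(X))$, $Y_{x*}^{[d]}(X)=\pi_*(Y_x^{[d]}(X))$. A subsystem of an $\mathcal F^{[d]}$-space is a nonempty closed $\mathcal F^{[d]}$-invariant subset; it is minimal if each of its points has dense orbit in it. Then $C_x^{[d]}(X)$ is nonempty, closed and $\mathcal F^{[d]}$-invariant, and $Y_x^{[d]}(X)$ is the unique minimal subsystem of $(\mathcal F^{[d]},C_x^{[d]}(X))$. Likewise $C_{x*}^{[d]}(X)$ is nonempty, closed and $\mathcal F^{[d]}$-invariant, and $Y_{x*}^{[d]}(X)$ is the unique minimal subsystem of $(\mathcal F^{[d]},C_{x*}^{[d]}(X))$. -/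

import Mathlib

namespace CubeDynamics

universe u v

/-- The discrete cube `{0,1}^d`; its vertex `0` is the constant function `0`. -/
abbrev Cube (d : ℕ) : Type := Fin d → Fin 2

/-- The discrete cube with the vertex `0` removed. -/
abbrev StarCube (d : ℕ) : Type := {ω : Cube d // ω ≠ 0}

/-- The hyperface `{ω | ω i = a}` of the discrete cube; it is upper when `a = 1`. -/
def hyperface {d : ℕ} (i : Fin d) (a : Fin 2) : Set (Cube d) := {ω | ω i = a}

section Groups

variable (d : ℕ) (G : Type u) [Group G]

/-- The Host-Kra cube group: the subgroup of `G^{[d]}` generated by the elements `[h]_F`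
(equal to `h` on `F` and to `1` off `F`), with `F` a hyperface and `h ∈ G`. -/
def hostKraGroup : Subgroup (Cube d → G) :=
  Subgroup.closure
    {γ | ∃ (i : Fin d) (a : Fin 2) (h : G), γ = (hyperface i a).mulIndicator (fun _ => h)}

/-- The face cube group: the subgroup of `G^{[d]}` generated by the elements `[h]_F`
with `F` an upper hyperface and `h ∈ G`. -/
def faceGroup : Subgroup (Cube d → G) :=
  Subgroup.closure
    {γ | ∃ (i : Fin d) (h : G), γ = (hyperface i 1).mulIndicator (fun _ => h)}

end Groups

/-- Restriction of a configuration to the nonzero vertices (forgetting the `0`-coordinate). -/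
def forgetZero {d : ℕ} {X : Type v} (c : Cube d → X) : StarCube d → X := fun ω => c ω.1

/-- The coordinatewise action of the face group on configurations indexed by the nonzero
vertices. (On full configurations the coordinatewise action is Mathlib's `Pi.mulAction'`.) -/
instance starAction (d : ℕ) (G : Type u) [Group G] (X : Type v) [MulAction G X] :
    MulAction (faceGroup d G) (StarCube d → X) where
  smul γ c := fun ω => γ.1 ω.1 • c ω
  one_smul c := funext fun ω => one_smul G (c ω)
  mul_smul γ γ' c := funext fun ω => mul_smul (γ.1 ω.1) (γ'.1 ω.1) (c ω)

section Cubes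

variable (d : ℕ) (G : Type u) [Group G] {X : Type v} [TopologicalSpace X] [MulAction G X]

/-- The constant configuration `x^{[d]}`. -/
def constConfig (x : X) : Cube d → X := fun _ => x

variable (X) in
/-- The dynamical cubes `C_G^{[d]}(X)`: the closure of the set of all `g x^{[d]}` with
`g` in the Host-Kra cube group and `x ∈ X`. -/
def cubes : Set (Cube d → X) :=
  closure {c | ∃ (g : hostKraGroup d G) (x : X), c = g • constConfig d x}

/-- `C_x^{[d]}(X)`: the dynamical cubes whose `0`-vertex is `x`. -/
def cubesAt (x : X) : Set (Cube d → X) := {c | c ∈ cubes d G X ∧ c 0 = x}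

/-- `C_{x*}^{[d]}(X)`: the image of `C_x^{[d]}(X)` after forgetting the `0`-coordinate. -/
def cubesAtStar (x : X) : Set (StarCube d → X) := forgetZero '' cubesAt d G x

/-- `Y_x^{[d]}(X)`: the orbit closure of `x^{[d]}` under the face group. -/
def faceOrbitClosure (x : X) : Set (Cube d → X) :=
  closure (MulAction.orbit (faceGroup d G) (constConfig d x))

/-- `Y_{x*}^{[d]}(X)`: the image of `Y_x^{[d]}(X)` after forgetting the `0`-coordinate. -/
def faceOrbitClosureStar (x : X) : Set (StarCube d → X) :=
  forgetZero '' faceOrbitClosure d G x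

end Cubes

section Subsystems

variable (H : Type u) [Group H] {Z : Type v} [TopologicalSpace Z] [MulAction H Z]

/-- `A` is a (nonempty, closed, invariant) subsystem of the `H`-space `Z`. -/
structure IsSubsystem (A : Set Z) : Prop where
  nonempty : A.Nonempty
  isClosed : IsClosed A
  smul_mem : ∀ (h : H), ∀ z ∈ A, h • z ∈ A

/-- `M` is a minimal subsystem of the system `(H, A)`: a subsystem contained in `A` in which
every orbit is dense. -/
structure IsMinimalSubsystem (A M : Set Z) : Prop where
  isSubsystem : IsSubsystem H M
  subset : M ⊆ A
  orbit_dense : ∀ z ∈ M, M ⊆ closure (MulAction.orbit H z)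

/-- `(H, A)` is a system and `M` is its unique minimal subsystem. -/
structure IsUniqueMinimalSubsystem (A M : Set Z) : Prop where
  system : IsSubsystem H A
  minimal : IsMinimalSubsystem H A M
  unique : ∀ M' : Set Z, IsMinimalSubsystem H A M' → M' = M

end Subsystems

end CubeDynamics

/-! Everything reduces to `constConfig_mem_closure_orbit`: the face orbit closure of any cube `c`
with `c 0 = x` contains `x^{[d]}`. A point of a system lying in all its orbit closures generates its
only minimal subsystem, and forgetting the vertex `0` is a closed equivariant map, so both halves of
the theorem follow.

Suppose first that `X` is second countable. A Baire argument (`exists_cubesAt_subset_closure_orbit`)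
yields one point `x₀` such that every cube at `x₀` is a face limit of `x₀^{[d]}`. The passage to an
arbitrary `x` is algebraic (`constConfig_mem_closure_orbit_of_exists`). Let `E` be the enveloping
semigroup and `u` a minimal idempotent fixing `x`, so that `u E u` is a group. The face group cuts
out a subgroup of `(u E u)^{[d]}` that is normalized by the diagonal (`diagonal_conj_mem`). If `p x
= x₀`, then `p u c` is a cube at `x₀`, hence a face limit of `x₀^{[d]}`. Conjugation by `α = u p`
turns this into an element `s` of the subgroup with `s x^{[d]} = u c`, and `s⁻¹` carries `u c`,
itself a face limit of `c`, back to `x^{[d]}`.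

For general `X`, one cube and one neighbourhood of `x^{[d]}` are treated at a time. A Urysohn
function and a countable subgroup `K`, obtained by a Löwenheim–Skolem closing-off, give a compact
second countable minimal factor of `(K, X)` in which the image of `c` is still a cube. -/

namespace CubeDynamics

open Topology Set TopologicalSpace

/-! ### Minimal left ideals and idempotents in compact right topological monoids. -/

section Ellis

variable {T : Type*} [Monoid T] [TopologicalSpace T]

/-- `M` is a minimal closed left ideal of the submonoid `C` of a topological monoid. -/
structure IsMinimalLeftIdeal (C : Submonoid T) (M : Set T) : Prop where
  nonempty : M.Nonempty
  isClosed : IsClosed M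
  subset : M ⊆ C
  mul_mem : ∀ p ∈ C, ∀ m ∈ M, p * m ∈ M
  transitive : ∀ m ∈ M, ∀ n ∈ M, ∃ p ∈ C, p * m = n

theorem exists_isMinimalLeftIdeal [CompactSpace T] [T2Space T] (hr : ∀ q : T, Continuous (· * q)) (C : Submonoid T)
    (hC : IsClosed (C : Set T)) : ∃ M, IsMinimalLeftIdeal C M := by
  let S : Set (Set T) :=
    {N | IsClosed N ∧ N.Nonempty ∧ N ⊆ C ∧ ∀ p ∈ C, ∀ m ∈ N, p * m ∈ N}
  obtain ⟨M, -, hM⟩ : ∃ M, M ⊆ (C : Set T) ∧ Minimal (· ∈ S) M := by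
    refine zorn_superset_nonempty S (fun c hcS hc hne => ?_) C
      ⟨hC, ⟨1, C.one_mem⟩, subset_rfl, fun p hp m hm => C.mul_mem hp hm⟩
    refine ⟨⋂₀ c, ⟨isClosed_sInter fun t ht => (hcS ht).1, ?_, ?_, ?_⟩,
      fun s hs => sInter_subset_of_mem hs⟩
    · have : Nonempty c := hne.coe_sort
      rw [sInter_eq_iInter]
      exact IsCompact.nonempty_iInter_of_directed_nonempty_isCompact_isClosed _
        (DirectedOn.directed_val (IsChain.directedOn hc.symm)) (fun i => (hcS i.2).2.1)
        (fun i => (hcS i.2).1.isCompact) (fun i => (hcS i.2).1)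
    · obtain ⟨s, hs⟩ := hne
      exact (sInter_subset_of_mem hs).trans (hcS hs).2.2.1
    · exact fun p hp m hm => mem_sInter.2 fun t ht => (hcS ht).2.2.2 p hp m (mem_sInter.1 hm t ht)
  obtain ⟨h1, h2, h3, h4⟩ := hM.prop
  refine ⟨M, h2, h1, h3, h4, fun m hm n hn => ?_⟩
  -- `C m` is a closed left ideal inside `M`, so minimality forces equality.
  have key : (· * m) '' (C : Set T) = M := by
    apply hM.eq_of_subset
    · refine ⟨(hr m).isClosedMap _ hC, ⟨_, 1, C.one_mem, rfl⟩, ?_, ?_⟩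
      · rintro _ ⟨p, hp, rfl⟩
        exact C.mul_mem hp (h3 hm)
      · rintro q hq _ ⟨p, hp, rfl⟩
        exact ⟨q * p, C.mul_mem hq hp, mul_assoc _ _ _⟩
    · rintro _ ⟨p, hp, rfl⟩
      exact h4 p hp m hm
  rw [← key] at hn
  exact hn

/-- The Ellis–Numakura lemma applied to the compact subsemigroup `C p`. -/
theorem exists_mul_idempotent [CompactSpace T] [T2Space T] (hr : ∀ q : T, Continuous (· * q)) (C : Submonoid T)
    (hC : IsClosed (C : Set T)) {p : T} (hp : p ∈ C) : ∃ q ∈ C, q * p * (q * p) = q * p := by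
  obtain ⟨_, ⟨q, hq, rfl⟩, h⟩ := exists_idempotent_in_compact_subsemigroup hr
    ((· * p) '' (C : Set T)) ⟨_, 1, C.one_mem, rfl⟩ ((hr p).isClosedMap _ hC).isCompact (by
      rintro _ ⟨a, ha, rfl⟩ _ ⟨b, hb, rfl⟩
      exact ⟨a * p * b, C.mul_mem (C.mul_mem ha hp) hb, mul_assoc _ _ _⟩)
  exact ⟨q, hq, h⟩

theorem IsMinimalLeftIdeal.mul_idempotent {C : Submonoid T} {M : Set T}
    (hM : IsMinimalLeftIdeal C M) {m e : T} (hm : m ∈ M) (he : e ∈ M) (hee : e * e = e) :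
    m * e = m := by
  obtain ⟨p, -, rfl⟩ := hM.transitive e he m hm
  rw [mul_assoc, hee]

/-- The closure of a set of left-continuous elements stable under multiplication is again
stable under multiplication. -/
theorem mul_mem_closure (hr : ∀ q : T, Continuous (· * q)) {Γ : Set T}
    (hl : ∀ γ ∈ Γ, Continuous (γ * ·)) (hmul : ∀ γ ∈ Γ, ∀ δ ∈ Γ, γ * δ ∈ Γ) {p q : T}
    (hp : p ∈ closure Γ) (hq : q ∈ closure Γ) : p * q ∈ closure Γ := by
  have h1 : ∀ γ ∈ Γ, γ * q ∈ closure Γ := fun γ hγ =>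
    map_mem_closure (hl γ hγ) hq (fun δ hδ => hmul γ hγ δ hδ)
  have := map_mem_closure (hr q) hp h1
  rwa [closure_closure] at this

end Ellis

/-! ### The group of a minimal idempotent. -/

section StructureGroup

variable {T : Type*} [Monoid T]

/-- `u` is an idempotent of `C` such that the left ideal `C u` is minimal. -/
structure IsMinimalIdempotent (C : Submonoid T) (u : T) : Prop where
  mem : u ∈ C
  idem : u * u = u
  exists_mul_eq : ∀ p ∈ C, ∃ q ∈ C, q * (p * u) = u

/-- The group `u C u` attached to a minimal idempotent `u` of `C`. -/
def StructureGroup {C : Submonoid T} {u : T} (_ : IsMinimalIdempotent C u) : Type _ :=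
  {p : T // p ∈ C ∧ u * p = p ∧ p * u = p}

variable {C : Submonoid T} {u : T} {hu : IsMinimalIdempotent C u}

/-- If `q * (p * u) = u`, then `u * q * u` is a left inverse of `p`; left axioms suffice for a
group. -/
noncomputable instance : Group (StructureGroup hu) :=
  letI : Mul (StructureGroup hu) := ⟨fun p q => ⟨p.1 * q.1, C.mul_mem p.2.1 q.2.1,
    by rw [← mul_assoc, p.2.2.1], by rw [mul_assoc, q.2.2.2]⟩⟩
  letI : One (StructureGroup hu) := ⟨⟨u, hu.mem, hu.idem, hu.idem⟩⟩
  letI : Inv (StructureGroup hu) := ⟨fun p =>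
    ⟨u * (hu.exists_mul_eq p.1 p.2.1).choose * u,
      C.mul_mem (C.mul_mem hu.mem (hu.exists_mul_eq p.1 p.2.1).choose_spec.1) hu.mem,
      by rw [← mul_assoc, ← mul_assoc, hu.idem], by rw [mul_assoc, hu.idem]⟩⟩
  Group.ofLeftAxioms (fun p q r => Subtype.ext (mul_assoc _ _ _)) (fun p => Subtype.ext p.2.2.1)
    (fun p => Subtype.ext (by
      have h := (hu.exists_mul_eq p.1 p.2.1).choose_spec.2
      change u * (hu.exists_mul_eq p.1 p.2.1).choose * u * p.1 = u
      generalize (hu.exists_mul_eq p.1 p.2.1).choose = q at h ⊢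
      rw [p.2.2.2] at h
      rw [mul_assoc, p.2.2.1, mul_assoc, h, hu.idem]))

theorem StructureGroup.coe_one : (1 : StructureGroup hu).1 = u := rfl

theorem StructureGroup.coe_mul (p q : StructureGroup hu) : (p * q).1 = p.1 * q.1 := rfl

/-- The element `u p u` of the structure group. -/
def StructureGroup.compress (hu : IsMinimalIdempotent C u) (p : T) (hp : p ∈ C) :
    StructureGroup hu :=
  ⟨u * p * u, C.mul_mem (C.mul_mem hu.mem hp) hu.mem,
    by rw [← mul_assoc, ← mul_assoc, hu.idem], by rw [mul_assoc, hu.idem]⟩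

end StructureGroup

/-- A subgroup of `Q^{[d]}` that contains the upper face elements, is trivial at the vertex `0`
and is stable under collapsing each coordinate direction is normalized by the diagonal. -/
theorem diagonal_conj_mem {d : ℕ} {Q : Type*} [Group Q] (S : Subgroup (Cube d → Q))
    (hzero : ∀ s ∈ S, s 0 = 1)
    (hface : ∀ (i : Fin d) (a : Q), ((hyperface i 1).mulIndicator fun _ => a) ∈ S)
    (hcol : ∀ (i : Fin d), ∀ s ∈ S, (fun ω => s (Function.update ω i 0)) ∈ S)
    (a : Q) {s : Cube d → Q} (hs : s ∈ S) : (fun ω => a * s ω * a⁻¹) ∈ S := by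
  classical
  -- Induction on a set `R` of coordinates on which `s` depends.
  have key : ∀ (R : Finset (Fin d)), ∀ s ∈ S,
      (∀ ω, s ω = s (fun i => if i ∈ R then ω i else 0)) → (fun ω => a * s ω * a⁻¹) ∈ S := by
    intro R
    induction R using Finset.induction_on with
    | empty =>
      intro s hs h
      have : (fun ω => a * s ω * a⁻¹) = 1 := by
        funext ω
        have h1 : s ω = 1 := by rw [h ω]; exact (congrArg s (by simp; rfl)).trans (hzero s hs)
        simp [h1]
      rw [this]
      exact S.one_mem
    | insert i R hi ih =>
      intro s hs h
      set s' : Cube d → Q := fun ω => s (Function.update ω i 0) with hs'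
      have hs'S : s' ∈ S := hcol i s hs
      have h1 : (fun ω => a * s' ω * a⁻¹) ∈ S := by
        refine ih s' hs'S fun ω => ?_
        simp only [hs']
        rw [h]
        congr 1
        funext j
        by_cases hj : j = i
        · subst hj; simp
        · simp [hj]
      -- Since `s'⁻¹ * s` is trivial where `ω i = 0`, conjugating it by the diagonal `a` is the same
      -- as conjugating it by `a` placed on the upper face, an element of `S`.
      have h2 : (hyperface i 1).mulIndicator (fun _ => a) * (s'⁻¹ * s) *
          ((hyperface i 1).mulIndicator (fun _ => a))⁻¹ ∈ S :=
        S.mul_mem (S.mul_mem (hface i a) (S.mul_mem (S.inv_mem hs'S) hs))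
          (S.inv_mem (hface i a))
      convert S.mul_mem h1 h2 using 1
      funext ω
      by_cases hω : ω ∈ hyperface i (1 : Fin 2)
      · simp [hω, mul_assoc]
      · have h0 : ω i = 0 := by
          have : ω i ≠ 1 := hω
          omega
        have h3 : s' ω = s ω := by
          simp only [hs']
          rw [← h0, Function.update_eq_self]
        simp [hω, h3]
  exact key Finset.univ s hs (fun ω => by simp)

/-! ### Enveloping semigroups of `G` and of the face group. -/

section Enveloping

variable {X : Type*} [TopologicalSpace X]

instance : TopologicalSpace (Function.End X) := inferInstanceAs (TopologicalSpace (X → X))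

instance [CompactSpace X] : CompactSpace (Function.End X) :=
  inferInstanceAs (CompactSpace (X → X))

instance [T2Space X] : T2Space (Function.End X) := inferInstanceAs (T2Space (X → X))

theorem continuous_end_eval (x : X) : Continuous fun p : Function.End X => p x :=
  continuous_apply (A := fun _ : X => X) x

theorem continuous_end_mul_right (q : Function.End X) : Continuous (· * q) :=
  continuous_pi (A := fun _ : X => X) fun x => continuous_end_eval (q x)

theorem continuous_end_mul_left {p : Function.End X} (hp : Continuous (p : X → X)) :
    Continuous (p * ·) :=
  continuous_pi (A := fun _ : X => X) fun x => hp.comp (continuous_end_eval x)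

theorem continuous_cubeEnd_mul_right {d : ℕ} (q : Cube d → Function.End X) :
    Continuous (· * q) :=
  continuous_pi fun ω => (continuous_end_mul_right (q ω)).comp (continuous_apply ω)

variable (d : ℕ) (G : Type*) [Group G] [MulAction G X] [ContinuousConstSMul G X]

variable (X) in
/-- The enveloping semigroup of `(G, X)`. -/
def envelope : Submonoid (Function.End X) where
  carrier := closure (range (MulAction.toEndHom (M := G) (α := X)))
  one_mem' := subset_closure ⟨1, map_one _⟩
  mul_mem' := mul_mem_closure continuous_end_mul_right
    (by rintro _ ⟨g, rfl⟩; exact continuous_end_mul_left (continuous_const_smul g))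
    (by rintro _ ⟨g, rfl⟩ _ ⟨h, rfl⟩; exact ⟨g * h, map_mul _ g h⟩)

/-- The coordinatewise transformations defined by the elements of the face group. -/
def faceMaps (X : Type*) [MulAction G X] : Set (Cube d → Function.End X) :=
  {φ | ∃ f ∈ faceGroup d G, φ = fun ω => MulAction.toEndHom (f ω)}

variable (X) in
/-- The enveloping semigroup of the action of the face group on `X^{[d]}`, as a set of
coordinatewise transformations. -/
def faceEnvelope : Submonoid (Cube d → Function.End X) where
  carrier := closure (faceMaps d G X)
  one_mem' := subset_closure ⟨1, one_mem _, by funext ω; exact (map_one _).symm⟩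
  mul_mem' := mul_mem_closure continuous_cubeEnd_mul_right
    (by
      rintro _ ⟨f, hf, rfl⟩
      exact continuous_pi fun ω => (continuous_end_mul_left
        (continuous_const_smul (f ω))).comp (continuous_apply ω))
    (by
      rintro _ ⟨f, hf, rfl⟩ _ ⟨f', hf', rfl⟩
      exact ⟨f * f', mul_mem hf hf', by funext ω; exact (map_mul (MulAction.toEndHom (M := G) (α := X)) (f ω) (f' ω)).symm⟩)

variable {d G}

theorem isClosed_envelope : IsClosed (envelope X G : Set (Function.End X)) := isClosed_closure

theorem isClosed_faceEnvelope : IsClosed (faceEnvelope X d G : Set (Cube d → Function.End X)) :=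
  isClosed_closure

omit [TopologicalSpace X] [MulAction G X] [ContinuousConstSMul G X] in
theorem faceGroup_apply_zero {f : Cube d → G} (hf : f ∈ faceGroup d G) : f 0 = 1 := by
  induction hf using Subgroup.closure_induction with
  | mem f hf =>
    obtain ⟨i, h, rfl⟩ := hf
    exact mulIndicator_of_notMem (by simp [hyperface]) _
  | one => rfl
  | mul f g _ _ hf hg => simp [hf, hg]
  | inv f _ hf => simp [hf]

theorem faceEnvelope_apply_zero [T2Space X] {φ : Cube d → Function.End X}
    (hφ : φ ∈ faceEnvelope X d G) : φ 0 = 1 := by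
  have : closure (faceMaps d G X) ⊆ {φ | φ 0 = 1} := by
    refine closure_minimal ?_ (isClosed_eq (continuous_apply 0) continuous_const)
    rintro _ ⟨f, hf, rfl⟩
    simp [faceGroup_apply_zero hf]
  exact this hφ

theorem faceEnvelope_apply_mem {φ : Cube d → Function.End X}
    (hφ : φ ∈ faceEnvelope X d G) (ω : Cube d) : φ ω ∈ envelope X G := by
  refine map_mem_closure (f := fun φ : Cube d → Function.End X => φ ω) (continuous_apply ω) hφ ?_
  rintro _ ⟨f, -, rfl⟩
  exact ⟨f ω, rfl⟩

/-- Collapsing a coordinate direction preserves the enveloping semigroup of the face group. -/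
theorem faceEnvelope_collapse {φ : Cube d → Function.End X} (hφ : φ ∈ faceEnvelope X d G)
    (i : Fin d) : (fun ω => φ (Function.update ω i 0)) ∈ faceEnvelope X d G := by
  refine map_mem_closure (f := fun (φ : Cube d → Function.End X) ω => φ (Function.update ω i 0))
    (continuous_pi fun ω => continuous_apply _) hφ ?_
  rintro _ ⟨f, hf, rfl⟩
  refine ⟨fun ω => f (Function.update ω i 0), ?_, rfl⟩
  induction hf using Subgroup.closure_induction with
  | mem f hf =>
    obtain ⟨j, h, rfl⟩ := hf
    by_cases hj : j = i
    · subst hj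
      convert one_mem (faceGroup d G) using 1
      funext ω
      exact mulIndicator_of_notMem (by simp [hyperface]) _
    · refine Subgroup.subset_closure ⟨j, h, ?_⟩
      funext ω
      by_cases hω : ω j = 1 <;> simp [mulIndicator, hyperface, hj, hω]
  | one => exact one_mem _
  | mul f g _ _ hf hg => exact mul_mem hf hg
  | inv f _ hf => exact inv_mem hf

/-- The element `p` placed on an upper hyperface. -/
theorem mulIndicator_mem_faceEnvelope {p : Function.End X} (hp : p ∈ envelope X G) (i : Fin d) :
    ((hyperface i 1).mulIndicator fun _ => p) ∈ faceEnvelope X d G := by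
  refine map_mem_closure
    (f := fun p : Function.End X => (hyperface i (1 : Fin 2)).mulIndicator fun _ => p)
    (continuous_pi fun ω => ?_) hp ?_
  · by_cases hω : ω ∈ hyperface i (1 : Fin 2)
    · simp only [mulIndicator_of_mem hω]; exact continuous_id
    · simpa [hω] using continuous_const
  · rintro _ ⟨g, rfl⟩
    refine ⟨_, Subgroup.subset_closure ⟨i, g, rfl⟩, ?_⟩
    funext ω
    by_cases hω : ω ∈ hyperface i (1 : Fin 2) <;> simp [hω]

/-- The element equal to the identity at the vertex `0` and to `p` elsewhere. -/
noncomputable def offZero (d : ℕ) (p : Function.End X) : Cube d → Function.End X :=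
  ({0}ᶜ : Set (Cube d)).mulIndicator fun _ => p

omit [TopologicalSpace X] in
@[simp] theorem offZero_zero (p : Function.End X) : offZero d p 0 = 1 := by simp [offZero]

omit [TopologicalSpace X] in
theorem offZero_of_ne {ω : Cube d} (hω : ω ≠ 0) (p : Function.End X) : offZero d p ω = p := by
  simp [offZero, hω]

/-- The product of the copies of `p` on all upper hyperfaces is a power of `p` at each vertex, with
exponent the number of ones; idempotence makes every positive power equal to `p`. -/
theorem offZero_mem_faceEnvelope {p : Function.End X} (hp : p ∈ envelope X G) (hpp : p * p = p) :
    offZero d p ∈ faceEnvelope X d G := by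
  classical
  have key : ∀ R : Finset (Fin d),
      ({ω : Cube d | ∃ i ∈ R, ω i = 1}.mulIndicator fun _ => p) ∈ faceEnvelope X d G := by
    intro R
    induction R using Finset.induction_on with
    | empty =>
      convert one_mem (faceEnvelope X d G) using 1
      funext ω
      simp
    | insert i R _ ih =>
      convert mul_mem (mulIndicator_mem_faceEnvelope hp i) ih using 1
      funext ω
      by_cases h1 : ω i = 1 <;> by_cases h2 : ∃ j ∈ R, ω j = 1 <;>
        simp [mulIndicator, hyperface, h1, h2, hpp]
  have huniv : ({0}ᶜ : Set (Cube d)) = {ω | ∃ i ∈ Finset.univ, ω i = 1} := by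
    ext ω
    change ω ≠ 0 ↔ ∃ i ∈ Finset.univ, ω i = 1
    simp only [Finset.mem_univ, true_and, ne_eq]
    rw [← not_iff_not, not_not, not_exists, funext_iff]
    refine forall_congr' fun i => ?_
    change ω i = 0 ↔ _
    omega
  unfold offZero
  rw [huniv]
  exact key Finset.univ

end Enveloping

/-! ### The subgroup of `(u E u)^{[d]}` coming from the face group. -/

section FaceStructureGroup

variable {X : Type*} [TopologicalSpace X] [CompactSpace X] [T2Space X]
  {G : Type*} [Group G] [MulAction G X] [ContinuousConstSMul G X]

/-- The subgroup `u E(F) u` of `(u E u)^{[d]}` cut out by the enveloping semigroup of the face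
group. -/
noncomputable def faceStructureGroup (d : ℕ) {u : Function.End X}
    (hu : IsMinimalIdempotent (envelope X G) u) : Subgroup (Cube d → StructureGroup hu) where
  carrier := {s | ∃ φ ∈ faceEnvelope X d G, ∀ ω, (s ω).1 = u * φ ω * u}
  one_mem' := ⟨1, one_mem _, fun ω => by
    change u = u * 1 * u
    rw [mul_one, hu.idem]⟩
  mul_mem' := by
    rintro s t ⟨φ, hφ, hs⟩ ⟨ψ, hψ, ht⟩
    -- The factor `offZero d u` supplies the middle `u` in `(u φ u) (u ψ u) = u (φ u ψ) u`.
    refine ⟨φ * offZero d u * ψ,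
      mul_mem (mul_mem hφ (offZero_mem_faceEnvelope hu.mem hu.idem)) hψ, fun ω => ?_⟩
    rw [Pi.mul_apply, StructureGroup.coe_mul, hs, ht]
    by_cases hω : ω = 0
    · subst hω
      simp [faceEnvelope_apply_zero hφ, faceEnvelope_apply_zero hψ, hu.idem]
    · simp only [Pi.mul_apply, offZero_of_ne hω]
      simp only [mul_assoc]
      rw [← mul_assoc u u (ψ ω * u), hu.idem]
  inv_mem' := by
    rintro s ⟨φ, hφ, hs⟩
    have hoff := offZero_mem_faceEnvelope (d := d) hu.mem hu.idem
    -- One `χ` serves all vertices at once. Off `0`, `χ ω * s ω` is an idempotent `e` of the minimal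
    -- left ideal `E u`, where `u * e = u`; hence `u χ u` inverts `s`.
    obtain ⟨χ, hχ, he⟩ := exists_mul_idempotent continuous_cubeEnd_mul_right _
      isClosed_faceEnvelope (mul_mem (mul_mem hoff hφ) hoff)
    refine ⟨χ, hχ, fun ω => ?_⟩
    suffices h : s⁻¹ ω = StructureGroup.compress hu (χ ω) (faceEnvelope_apply_mem hχ ω) by
      rw [h]; rfl
    rw [Pi.inv_apply]
    refine inv_eq_of_mul_eq_one_left (Subtype.ext ?_)
    rw [StructureGroup.coe_mul, StructureGroup.coe_one]
    change u * χ ω * u * (s ω).1 = u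
    rw [mul_assoc, (s ω).2.2.1]
    by_cases hω : ω = 0
    · subst hω
      rw [hs, faceEnvelope_apply_zero hχ, faceEnvelope_apply_zero hφ]
      simp [hu.idem]
    · have h1 := congrFun he ω
      simp only [Pi.mul_apply, offZero_of_ne hω] at h1
      rw [← hs] at h1
      obtain ⟨q, -, hq⟩ := hu.exists_mul_eq (χ ω * (s ω).1)
        (mul_mem (faceEnvelope_apply_mem hχ ω) (s ω).2.1)
      rw [mul_assoc (χ ω), (s ω).2.2.2] at hq
      calc u * χ ω * (s ω).1 = q * (χ ω * (s ω).1) * (χ ω * (s ω).1) := by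
            rw [hq, mul_assoc]
        _ = q * (χ ω * (s ω).1) := by rw [mul_assoc, h1]
        _ = u := hq

/-- The group `u E(F) u` is normalized by the diagonal. -/
theorem faceStructureGroup_conj_mem {d : ℕ} {u : Function.End X}
    {hu : IsMinimalIdempotent (envelope X G) u} {s : Cube d → StructureGroup hu}
    (hs : s ∈ faceStructureGroup d hu) (a : StructureGroup hu) :
    (fun ω => a * s ω * a⁻¹) ∈ faceStructureGroup d hu := by
  refine diagonal_conj_mem _ ?_ ?_ ?_ a hs
  · rintro s ⟨φ, hφ, h⟩
    refine Subtype.ext ?_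
    rw [h, faceEnvelope_apply_zero hφ, mul_one, hu.idem, StructureGroup.coe_one]
  · intro i a
    refine ⟨_, mulIndicator_mem_faceEnvelope a.2.1 i, fun ω => ?_⟩
    by_cases hω : ω ∈ hyperface i (1 : Fin 2)
    · simp only [mulIndicator_of_mem hω]
      rw [a.2.2.1, a.2.2.2]
    · simp only [mulIndicator_of_notMem hω]
      rw [mul_one, hu.idem, StructureGroup.coe_one]
  · rintro i s ⟨φ, hφ, h⟩
    exact ⟨_, faceEnvelope_collapse hφ i, fun ω => h _⟩

end FaceStructureGroup

/-! ### Host–Kra group, dynamical cubes and the Baire argument. -/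

section HostKra

variable {d : ℕ} {G : Type*} [Group G]

theorem faceGroup_le_hostKraGroup : faceGroup d G ≤ hostKraGroup d G :=
  Subgroup.closure_mono fun _ ⟨i, h, e⟩ => ⟨i, 1, h, e⟩

theorem conj_mem_faceGroup {f : Cube d → G} (hf : f ∈ faceGroup d G) (g : G) :
    (fun ω => g * f ω * g⁻¹) ∈ faceGroup d G := by
  induction hf using Subgroup.closure_induction with
  | mem f hf =>
    obtain ⟨i, h, rfl⟩ := hf
    refine Subgroup.subset_closure ⟨i, g * h * g⁻¹, ?_⟩
    funext ω
    by_cases hω : ω ∈ hyperface i (1 : Fin 2) <;> simp [hω]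
  | one => convert one_mem (faceGroup d G) using 1; funext ω; simp
  | mul f f' _ _ hf hf' => convert mul_mem hf hf' using 1; funext ω; simp
  | inv f _ hf => convert inv_mem hf using 1; funext ω; simp [mul_assoc]

/-- Each element of the Host-Kra group is the product of an element of the face group and a
diagonal element. -/
theorem exists_face_mul_diagonal {h : Cube d → G} (hh : h ∈ hostKraGroup d G) :
    ∃ f ∈ faceGroup d G, ∃ g : G, ∀ ω, h ω = f ω * g := by
  induction hh using Subgroup.closure_induction with
  | mem h hh =>
    obtain ⟨i, a, h, rfl⟩ := hh
    obtain rfl | rfl : a = 0 ∨ a = 1 := by omega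
    -- `h` on a lower face is `h⁻¹` on the opposite upper face times the diagonal `h`.
    · refine ⟨_, Subgroup.subset_closure ⟨i, h⁻¹, rfl⟩, h, fun ω => ?_⟩
      obtain hω | hω : ω i = 0 ∨ ω i = 1 := by omega
      · simp [mulIndicator, hyperface, hω]
      · simp [mulIndicator, hyperface, hω]
    · exact ⟨_, Subgroup.subset_closure ⟨i, h, rfl⟩, 1, fun ω => (mul_one _).symm⟩
  | one => exact ⟨1, one_mem _, 1, fun ω => by simp⟩
  | mul h h' _ _ ih ih' =>
    obtain ⟨f, hf, g, e⟩ := ih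
    obtain ⟨f', hf', g', e'⟩ := ih'
    exact ⟨_, mul_mem hf (conj_mem_faceGroup hf' g), g * g', fun ω => by
      simp [e, e', mul_assoc]⟩
  | inv h _ ih =>
    obtain ⟨f, hf, g, e⟩ := ih
    exact ⟨_, conj_mem_faceGroup (inv_mem hf) g⁻¹, g⁻¹, fun ω => by simp [e, mul_assoc]⟩

theorem diagonal_mem_hostKraGroup (hd : 1 ≤ d) (g : G) :
    (fun _ => g) ∈ hostKraGroup d G := by
  have i : Fin d := ⟨0, hd⟩
  have hgen : ∀ a : Fin 2, ((hyperface i a).mulIndicator fun _ => g) ∈ hostKraGroup d G :=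
    fun a => Subgroup.subset_closure ⟨i, a, g, rfl⟩
  convert mul_mem (hgen 0) (hgen 1) using 1
  funext ω
  obtain hω | hω : ω i = 0 ∨ ω i = 1 := by omega
  · simp [mulIndicator, hyperface, hω]
  · simp [mulIndicator, hyperface, hω]

variable {X : Type*} [TopologicalSpace X] [MulAction G X]

theorem constConfig_mem_cubes (x : X) : constConfig d x ∈ cubes d G X :=
  subset_closure ⟨1, x, (one_smul _ _).symm⟩

theorem smul_mem_cubes [ContinuousConstSMul G X] {h : Cube d → G} (hh : h ∈ hostKraGroup d G)
    {c : Cube d → X} (hc : c ∈ cubes d G X) : (fun ω => h ω • c ω) ∈ cubes d G X := by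
  refine map_mem_closure (f := fun (c : Cube d → X) ω => h ω • c ω)
    (continuous_pi fun ω => (continuous_apply ω).const_smul _) hc ?_
  rintro _ ⟨k, x, rfl⟩
  exact ⟨⟨h, hh⟩ * k, x, (mul_smul (⟨h, hh⟩ : hostKraGroup d G) k (constConfig d x)).symm⟩

theorem envelope_mem_cubes [ContinuousConstSMul G X] (hd : 1 ≤ d) {p : Function.End X}
    (hp : p ∈ envelope X G) {c : Cube d → X} (hc : c ∈ cubes d G X) :
    (fun ω => p (c ω)) ∈ cubes d G X := by
  have := map_mem_closure (f := fun (p : Function.End X) ω => p (c ω)) (t := cubes d G X)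
    (continuous_pi fun ω => continuous_end_eval (c ω)) hp (by
      rintro _ ⟨g, rfl⟩
      exact smul_mem_cubes (diagonal_mem_hostKraGroup hd g) hc)
  rwa [cubes, closure_closure] at this

theorem face_smul_mem_cubesAt [ContinuousConstSMul G X] {x : X} (f : faceGroup d G)
    {c : Cube d → X} (hc : c ∈ cubesAt d G x) : f • c ∈ cubesAt d G x := by
  refine ⟨smul_mem_cubes (faceGroup_le_hostKraGroup f.2) hc.1, ?_⟩
  change f.1 0 • c 0 = x
  rw [faceGroup_apply_zero f.2, one_smul, hc.2]

theorem faceEnvelope_mem_closure_orbit [ContinuousConstSMul G X] {φ : Cube d → Function.End X}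
    (hφ : φ ∈ faceEnvelope X d G) (c : Cube d → X) :
    (fun ω => φ ω (c ω)) ∈ closure (MulAction.orbit (faceGroup d G) c) := by
  refine map_mem_closure (f := fun (φ : Cube d → Function.End X) ω => φ ω (c ω))
    (continuous_pi fun ω => (continuous_end_eval (c ω)).comp (continuous_apply ω)) hφ ?_
  rintro _ ⟨f, hf, rfl⟩
  exact ⟨⟨f, hf⟩, rfl⟩

/-- By compactness the evaluation image of the face envelope is closed, so every face limit of `c`
is attained by an element of the envelope. -/
theorem exists_faceEnvelope_eq [ContinuousConstSMul G X] [CompactSpace X] [T2Space X]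
    {b c : Cube d → X} (hb : b ∈ closure (MulAction.orbit (faceGroup d G) c)) :
    ∃ φ ∈ faceEnvelope X d G, ∀ ω, φ ω (c ω) = b ω := by
  have hcont : Continuous fun (φ : Cube d → Function.End X) ω => φ ω (c ω) :=
    continuous_pi fun ω => (continuous_end_eval (c ω)).comp (continuous_apply ω)
  have : closure (MulAction.orbit (faceGroup d G) c) ⊆
      (fun (φ : Cube d → Function.End X) ω => φ ω (c ω)) '' (faceEnvelope X d G) := by
    refine closure_minimal ?_ (hcont.isClosedMap _ isClosed_faceEnvelope)
    rintro _ ⟨f, rfl⟩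
    exact ⟨_, subset_closure ⟨f.1, f.2, rfl⟩, rfl⟩
  obtain ⟨φ, hφ, h⟩ := this hb
  exact ⟨φ, hφ, fun ω => congrFun h ω⟩

theorem closure_orbit_subset {H Z : Type*} [Group H] [TopologicalSpace Z] [MulAction H Z]
    [ContinuousConstSMul H Z] {y z : Z} (h : y ∈ closure (MulAction.orbit H z)) :
    closure (MulAction.orbit H y) ⊆ closure (MulAction.orbit H z) := by
  refine closure_minimal ?_ isClosed_closure
  rintro _ ⟨g, rfl⟩
  refine map_mem_closure (continuous_const_smul g) h ?_
  rintro _ ⟨k, rfl⟩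
  exact ⟨g * k, mul_smul g k z⟩

/-- In the second countable case the cubes at some vertex are face limits of the constant
configuration. -/
theorem exists_cubesAt_subset_closure_orbit [ContinuousConstSMul G X] [CompactSpace X] [T2Space X]
    [SecondCountableTopology X] [Nonempty X] :
    ∃ x : X, ∀ c ∈ cubesAt d G x,
      c ∈ closure (MulAction.orbit (faceGroup d G) (constConfig d x)) := by
  let V : Set (Cube d → X) → Set X := fun U => {y | ∃ f : faceGroup d G, f • constConfig d y ∈ U}
  have hV : ∀ U, IsOpen U → IsOpen (V U) := by
    intro U hU
    have : V U = ⋃ f : faceGroup d G, (fun y => f • constConfig d y) ⁻¹' U := by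
      ext y; simp [V]
    rw [this]
    refine isOpen_iUnion fun f => hU.preimage (continuous_pi fun ω => ?_)
    exact continuous_const_smul (f.1 ω)
  -- By Baire, some `x` avoids the boundary of `V U` for every basic `U`; then `x ∈ closure (V U)`
  -- already gives `x ∈ V U`.
  obtain ⟨x, hx⟩ := (dense_biInter_of_isOpen (S := TopologicalSpace.countableBasis (Cube d → X))
    (f := fun U => V U ∪ (closure (V U))ᶜ)
    (fun U hU => (hV U (TopologicalSpace.isOpen_of_mem_countableBasis hU)).union
      isClosed_closure.isOpen_compl) (TopologicalSpace.countable_countableBasis _) (by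
        intro U hU
        rw [dense_iff_closure_eq, closure_union, eq_univ_iff_forall]
        intro y
        by_cases hy : y ∈ closure (V U)
        · exact Or.inl hy
        · exact Or.inr (subset_closure hy))).nonempty
  refine ⟨x, fun c hc => ?_⟩
  rw [(TopologicalSpace.isBasis_countableBasis _).mem_closure_iff]
  intro U hU hcU
  have hxU : x ∈ V U := by
    refine (mem_iInter₂.1 hx U hU).resolve_right (not_not_intro ?_)
    rw [mem_closure_iff]
    intro O hO hxO
    have hUO : IsOpen (U ∩ {b : Cube d → X | b 0 ∈ O}) :=
      (TopologicalSpace.isOpen_of_mem_countableBasis hU).inter (hO.preimage (continuous_apply 0))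
    obtain ⟨_, ⟨hU', hO'⟩, h, y, rfl⟩ := mem_closure_iff.1 hc.1 _ hUO ⟨hcU, by
      change c 0 ∈ O; rwa [hc.2]⟩
    -- The approximating cube is a face translate of `(g y)^{[d]}`. Face elements are trivial at
    -- `0`, so its vertex `0` is `g y`, which therefore lies in `O`.
    obtain ⟨f, hf, g, e⟩ := exists_face_mul_diagonal h.2
    have e' : h • constConfig d y = (⟨f, hf⟩ : faceGroup d G) • constConfig d (g • y) := by
      funext ω
      change h.1 ω • y = f ω • g • y
      rw [e, mul_smul]
    rw [e'] at hU' hO'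
    refine ⟨g • y, ?_, ⟨f, hf⟩, hU'⟩
    have : f 0 • g • y ∈ O := hO'
    rwa [faceGroup_apply_zero hf, one_smul] at this
  obtain ⟨f, hf⟩ := hxU
  exact ⟨_, hf, f, rfl⟩

end HostKra

/-! ### Transfer from one base point to all, and the second countable case. -/

section Minimal

variable {X : Type*} [TopologicalSpace X] [CompactSpace X] [T2Space X]
  {G : Type*} [Group G] [MulAction G X] [ContinuousConstSMul G X]

omit [CompactSpace X] [T2Space X] in
theorem IsMinimalLeftIdeal.isMinimalIdempotent {M : Set (Function.End X)}
    (hM : IsMinimalLeftIdeal (envelope X G) M) {u : Function.End X} (hu : u ∈ M)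
    (huu : u * u = u) : IsMinimalIdempotent (envelope X G) u where
  mem := hM.subset hu
  idem := huu
  exists_mul_eq p hp := hM.transitive _ (hM.mul_mem p hp u hu) u hu

/-- The evaluations of `M` at `x` form a nonempty closed `G`-invariant set, which is all of `X` by
minimality. -/
theorem IsMinimalLeftIdeal.exists_apply_eq [MulAction.IsMinimal G X] {M : Set (Function.End X)}
    (hM : IsMinimalLeftIdeal (envelope X G) M) (x y : X) : ∃ p ∈ M, p x = y := by
  obtain ⟨m, hm⟩ := hM.nonempty
  have hsub : closure (MulAction.orbit G (m x)) ⊆ (fun p : Function.End X => p x) '' M := by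
    refine closure_minimal ?_ ((continuous_end_eval x).isClosedMap _ hM.isClosed)
    rintro _ ⟨g, rfl⟩
    exact ⟨MulAction.toEndHom g * m, hM.mul_mem _ (subset_closure ⟨g, rfl⟩) m hm, rfl⟩
  exact hsub (by rw [(MulAction.dense_orbit G (m x)).closure_eq]; trivial)

theorem IsMinimalLeftIdeal.exists_idempotent_fixing [MulAction.IsMinimal G X]
    {M : Set (Function.End X)} (hM : IsMinimalLeftIdeal (envelope X G) M) (x : X) :
    ∃ u ∈ M, u * u = u ∧ u x = x := by
  obtain ⟨u, ⟨hu, hux⟩, huu⟩ := exists_idempotent_in_compact_subsemigroup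
    (continuous_end_mul_right (X := X)) (M ∩ {p | p x = x})
    (hM.exists_apply_eq x x)
    (hM.isClosed.inter (isClosed_eq (continuous_end_eval x) continuous_const)).isCompact (by
      rintro p ⟨hp, hpx⟩ q ⟨hq, hqx⟩
      refine ⟨hM.mul_mem p (hM.subset hp) q hq, ?_⟩
      change p (q x) = x
      rw [hqx, hpx])
  exact ⟨u, hu, huu, hux⟩

instance {d : ℕ} : ContinuousConstSMul (faceGroup d G) (Cube d → X) :=
  ⟨fun f => continuous_pi fun ω => (continuous_apply ω).const_smul (f.1 ω)⟩

/-- If the face orbit closure of one constant configuration `x₀^{[d]}` contains all cubes at `x₀`,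
then the face orbit closure of any cube at any `x` contains `x^{[d]}`. -/
theorem constConfig_mem_closure_orbit_of_exists [MulAction.IsMinimal G X] {d : ℕ} (hd : 1 ≤ d)
    {x₀ : X} (hx₀ : ∀ c ∈ cubesAt d G x₀,
      c ∈ closure (MulAction.orbit (faceGroup d G) (constConfig d x₀)))
    {x : X} {c : Cube d → X} (hc : c ∈ cubesAt d G x) :
    constConfig d x ∈ closure (MulAction.orbit (faceGroup d G) c) := by
  obtain ⟨M, hM⟩ := exists_isMinimalLeftIdeal continuous_end_mul_right (envelope X G)
    isClosed_envelope
  obtain ⟨u, huM, huu, hux⟩ := hM.exists_idempotent_fixing x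
  have hu := hM.isMinimalIdempotent huM huu
  have hoff := offZero_mem_faceEnvelope (d := d) hu.mem huu
  have huu' : ∀ y, u (u y) = u y := fun y => congrFun huu y
  -- As `u x = x`, applying `u` at every vertex or only off `0` gives the same `b`: the first shows
  -- that `b` is a cube, the second that it is a face limit of `c`.
  set b : Cube d → X := fun ω => u (c ω) with hb
  have hb0 : b 0 = x := by simp [hb, hc.2, hux]
  have hbC : b ∈ cubes d G X := envelope_mem_cubes hd hu.mem hc.1
  have hbc : b ∈ closure (MulAction.orbit (faceGroup d G) c) := by
    convert faceEnvelope_mem_closure_orbit hoff c using 1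
    funext ω
    by_cases hω : ω = 0
    · subst hω
      rw [hb0, offZero_zero]
      exact hc.2.symm
    · rw [offZero_of_ne hω]
  obtain ⟨p, hpM, hpx⟩ := hM.exists_apply_eq x x₀
  have hp := hM.subset hpM
  have hpu : p * u = p := hM.mul_idempotent hpM huM huu
  let α : StructureGroup hu := StructureGroup.compress hu p hp
  have hα : α.1 = u * p := by
    change u * p * u = u * p
    rw [mul_assoc, hpu]
  have hβα : α⁻¹.1 * α.1 = u := congrArg Subtype.val (inv_mul_cancel α)
  have hβ := α⁻¹.2
  set β := α⁻¹.1
  -- The point `α x = u x₀` may differ from `x₀`; the idempotent `p * β` sends it back to `p x =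
  -- x₀`, where `φ` can be applied.
  have hpβ : p * β * u * p = p := by
    rw [mul_assoc, ← hα, mul_assoc, hβα, hpu]
  have hv : p * β ∈ envelope X G := mul_mem hp hβ.1
  have hvv : p * β * (p * β) = p * β := by
    calc p * β * (p * β) = p * (β * u) * p * β := by rw [hβ.2.2]; simp only [mul_assoc]
      _ = p * β * u * p * β := by simp only [mul_assoc]
      _ = p * β := by rw [hpβ]
  obtain ⟨φ, hφ, hφb⟩ := exists_faceEnvelope_eq (hx₀ (fun ω => p (b ω))
    ⟨envelope_mem_cubes hd hp hbC, (congrArg p hb0).trans hpx⟩)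
  have hψ : φ * offZero d (p * β) ∈ faceEnvelope X d G :=
    mul_mem hφ (offZero_mem_faceEnvelope hv hvv)
  let s₁ : Cube d → StructureGroup hu := fun ω =>
    StructureGroup.compress hu _ (faceEnvelope_apply_mem hψ ω)
  have hs₁ : s₁ ∈ faceStructureGroup d hu := ⟨_, hψ, fun ω => rfl⟩
  have hs := faceStructureGroup_conj_mem hs₁ α⁻¹
  have hαb : ∀ ω, (s₁ ω).1 (α.1 x) = α.1 (b ω) := by
    intro ω
    change u ((φ * offZero d (p * β)) ω (u (α.1 x))) = α.1 (b ω)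
    rw [show u (α.1 x) = α.1 x from congrFun α.2.2.1 x]
    by_cases hω : ω = 0
    · subst hω
      rw [Pi.mul_apply, faceEnvelope_apply_zero hφ, offZero_zero, hb0]
      exact congrFun α.2.2.1 x
    · rw [Pi.mul_apply, offZero_of_ne hω, hα]
      change u (φ ω ((p * β * u * p) x)) = u (p (b ω))
      rw [hpβ, hpx, ← hφb ω]
      rfl
  -- `s₁` carries `α x` to `α b`, so its conjugate by `α⁻¹` carries `x` to `u b = b`.
  have hsx : ∀ ω, ((α⁻¹ * s₁ ω * α⁻¹⁻¹ : StructureGroup hu)).1 x = b ω := by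
    intro ω
    rw [inv_inv]
    change β ((s₁ ω).1 (α.1 x)) = b ω
    rw [hαb]
    change (β * α.1) (b ω) = b ω
    rw [hβα]
    exact huu' _
  obtain ⟨χ, hχ, hχs⟩ := inv_mem hs
  refine closure_orbit_subset hbc ?_
  -- Sandwiching `χ` gives `u χ u = s⁻¹` off `0` and leaves the vertex `0`, already equal to `x`,
  -- untouched.
  convert faceEnvelope_mem_closure_orbit (mul_mem (mul_mem hoff hχ) hoff) b using 1
  funext ω
  simp only [Pi.mul_apply]
  by_cases hω : ω = 0
  · subst hω
    rw [faceEnvelope_apply_zero hχ, offZero_zero]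
    exact hb0.symm
  · rw [offZero_of_ne hω, ← hχs ω, Pi.inv_apply, ← hsx ω]
    change x = ((α⁻¹ * s₁ ω * α⁻¹⁻¹)⁻¹ * (α⁻¹ * s₁ ω * α⁻¹⁻¹) : StructureGroup hu).1 x
    rw [inv_mul_cancel]
    exact hux.symm

theorem constConfig_mem_closure_orbit_of_secondCountable [SecondCountableTopology X]
    [MulAction.IsMinimal G X] {d : ℕ} (hd : 1 ≤ d) {x : X} {c : Cube d → X}
    (hc : c ∈ cubesAt d G x) :
    constConfig d x ∈ closure (MulAction.orbit (faceGroup d G) c) := by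
  have : Nonempty X := ⟨x⟩
  obtain ⟨x₀, hx₀⟩ := exists_cubesAt_subset_closure_orbit (d := d) (G := G) (X := X)
  exact constConfig_mem_closure_orbit_of_exists hd hx₀ hc

end Minimal

/-! ### Closing off countable subgroups. -/

section CountableSubgroup

variable {G : Type*} [Group G]

theorem countable_subgroup_closure {s : Set G} (hs : s.Countable) :
    Countable (Subgroup.closure s) := by
  have := hs.to_subtype
  have : Countable (FreeGroup s) := inferInstanceAs (Countable (Quot _))
  have h : (Subgroup.closure s : Set G) = range (FreeGroup.lift ((↑) : s → G)) := by
    rw [← MonoidHom.coe_range, FreeGroup.range_lift_eq_closure, Subtype.range_coe]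
  exact (h ▸ countable_range _ : (Subgroup.closure s : Set G).Countable).to_subtype

/-- There are countable subgroups closed under any operation that assigns countable sets to
finite sets. -/
theorem exists_countable_subgroup (S : Finset G → Set G) (hS : ∀ t, (S t).Countable) :
    ∃ K : Subgroup G, Countable K ∧ ∀ t : Finset G, (t : Set G) ⊆ K → S t ⊆ K := by
  let step : Subgroup G → Subgroup G := fun K =>
    Subgroup.closure (K ∪ ⋃ t ∈ {t : Finset G | (t : Set G) ⊆ K}, S t)
  have hle : ∀ K, K ≤ step K := fun K g hg => Subgroup.subset_closure (Or.inl hg)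
  let K : ℕ → Subgroup G := fun n => step^[n] ⊥
  have hsucc : ∀ n, K (n + 1) = step (K n) := fun n => Function.iterate_succ_apply' step n ⊥
  have hmono : Monotone K := monotone_nat_of_le_succ fun n => by rw [hsucc]; exact hle _
  have hcount : ∀ n, Countable (K n) := by
    intro n
    induction n with
    | zero => exact inferInstanceAs (Countable (⊥ : Subgroup G))
    | succ n ih =>
      rw [hsucc]
      have hK : (K n : Set G).Countable := to_countable _
      refine countable_subgroup_closure (hK.union (Countable.biUnion ?_ fun t _ => hS t))
      refine (((countable_ofPred_finite_subset hK).preimage Finset.coe_injective)).mono ?_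
      exact fun t ht => ⟨t.finite_toSet, ht⟩
  have hdir : Directed (· ≤ ·) K := hmono.directed_le
  refine ⟨⨆ n, K n, ?_, fun t ht => ?_⟩
  · have : ((⨆ n, K n : Subgroup G) : Set G).Countable := by
      rw [Subgroup.coe_iSup_of_directed hdir]
      exact countable_iUnion fun n => to_countable _
    exact this.to_subtype
  · rw [Subgroup.coe_iSup_of_directed hdir] at ht ⊢
    -- A finite subset of the union lies in some stage `n`, and its set `S t` is adjoined at stage
    -- `n + 1`.
    obtain ⟨n, hn⟩ := Directed.exists_mem_subset_of_finset_subset_biUnion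
      (f := fun n => (K n : Set G)) hdir ht
    refine subset_iUnion_of_subset (n + 1) ?_
    rw [hsucc]
    exact fun g hg => Subgroup.subset_closure (Or.inr (mem_biUnion hn hg))

/-- An element is a finite word in the generators, so any subgroup containing its finitely many
letters suffices. -/
theorem exists_finite_hostKraGroup_support {d : ℕ} {h : Cube d → G} (hh : h ∈ hostKraGroup d G) :
    ∃ s : Set G, s.Finite ∧ ∀ K : Subgroup G, s ⊆ K →
      ∃ k ∈ hostKraGroup d K, ∀ ω, (k ω : G) = h ω := by
  induction hh using Subgroup.closure_induction with
  | mem h hh =>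
    obtain ⟨i, a, g, rfl⟩ := hh
    refine ⟨{g}, finite_singleton g, fun K hK => ?_⟩
    refine ⟨_, Subgroup.subset_closure ⟨i, a, ⟨g, hK rfl⟩, rfl⟩, fun ω => ?_⟩
    by_cases hω : ω ∈ hyperface i a <;> simp [hω]
  | one => exact ⟨∅, finite_empty, fun K _ => ⟨1, one_mem _, fun ω => rfl⟩⟩
  | mul h h' _ _ ih ih' =>
    obtain ⟨s, hs, e⟩ := ih
    obtain ⟨s', hs', e'⟩ := ih'
    refine ⟨s ∪ s', hs.union hs', fun K hK => ?_⟩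
    obtain ⟨k, hk, hkh⟩ := e K (subset_union_left.trans hK)
    obtain ⟨k', hk', hkh'⟩ := e' K (subset_union_right.trans hK)
    exact ⟨k * k', mul_mem hk hk', fun ω => by simp [hkh, hkh']⟩
  | inv h _ ih =>
    obtain ⟨s, hs, e⟩ := ih
    refine ⟨s, hs, fun K hK => ?_⟩
    obtain ⟨k, hk, hkh⟩ := e K hK
    exact ⟨k⁻¹, inv_mem hk, fun ω => by simp [hkh]⟩

theorem coe_mem_faceGroup {d : ℕ} {K : Subgroup G} {f : Cube d → K} (hf : f ∈ faceGroup d K) :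
    (fun ω => (f ω : G)) ∈ faceGroup d G := by
  induction hf using Subgroup.closure_induction with
  | mem f hf =>
    obtain ⟨i, h, rfl⟩ := hf
    refine Subgroup.subset_closure ⟨i, h, ?_⟩
    funext ω
    by_cases hω : ω ∈ hyperface i (1 : Fin 2) <;> simp [hω]
  | one => exact one_mem _
  | mul f f' _ _ hf hf' => exact mul_mem hf hf'
  | inv f _ hf => exact inv_mem hf

end CountableSubgroup

/-! ### Second countable factors generated by one function. -/

section OrbitFactor

variable {G : Type*} [Group G] {X : Type*} [MulAction G X]

/-- The values of `f` along the `K`-orbit of a point. -/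
def orbitValues (f : X → ℝ) (K : Subgroup G) (y : X) : K → ℝ := fun k => f (k • y)

/-- The factor of `(K, X)` generated by the function `f`. -/
abbrev OrbitFactor (f : X → ℝ) (K : Subgroup G) : Type _ := range (orbitValues f K)

variable {f : X → ℝ} {K : Subgroup G}

instance : MulAction K (OrbitFactor f K) where
  smul k w := ⟨fun j => w.1 (j * k), by
    obtain ⟨_, y, rfl⟩ := w
    exact ⟨k • y, funext fun j => congrArg f (mul_smul j k y).symm⟩⟩
  one_smul w := Subtype.ext (funext fun j => congrArg w.1 (mul_one j))
  mul_smul k k' w := Subtype.ext (funext fun j => congrArg w.1 (mul_assoc j k k').symm)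

/-- The factor map onto the factor generated by `f`. -/
def toOrbitFactor (f : X → ℝ) (K : Subgroup G) (y : X) : OrbitFactor f K :=
  ⟨orbitValues f K y, y, rfl⟩

theorem toOrbitFactor_smul (k : K) (y : X) :
    toOrbitFactor f K (k • y) = k • toOrbitFactor f K y :=
  Subtype.ext (funext fun j => congrArg f (mul_smul j k y).symm)

theorem toOrbitFactor_surjective : Function.Surjective (toOrbitFactor f K) := by
  rintro ⟨_, y, rfl⟩
  exact ⟨y, rfl⟩

instance : ContinuousConstSMul K (OrbitFactor f K) :=
  ⟨fun k => continuous_induced_rng.2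
    (continuous_pi fun j => (continuous_apply (j * k)).comp continuous_subtype_val)⟩

/-- The values of `f` at the translates of a configuration by a finite set. -/
def sampleValues {ι : Type*} (f : X → ℝ) (t : Finset G) (c : ι → X) : ι → t → ℝ :=
  fun i j => f ((j : G) • c i)

/-- Open sets of the factor depend locally on finitely many orbit values. The resulting data `t`,
`B` do not mention `K`, so conditions on them can be imposed before `K` is built. -/
theorem exists_sampleValues_basis {ι : Type*} [Finite ι] {O : Set (ι → OrbitFactor f K)}
    (hO : IsOpen O) {c : ι → X} (hc : (fun i => toOrbitFactor f K (c i)) ∈ O) :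
    ∃ t : Finset G, (t : Set G) ⊆ K ∧ ∃ B ∈ countableBasis (ι → t → ℝ), sampleValues f t c ∈ B ∧
      ∀ b : ι → X, sampleValues f t b ∈ B → (fun i => toOrbitFactor f K (b i)) ∈ O := by
  classical
  have := Fintype.ofFinite ι
  obtain ⟨u, hu, huO⟩ := isOpen_pi_iff'.1 hO _ hc
  choose O' hO' e using fun i => isOpen_induced_iff.1 (hu i).1
  have hmem : ∀ i, orbitValues f K (c i) ∈ O' i := fun i => by
    have := (hu i).2
    rw [← e i] at this
    exact this
  choose I v hv hvO using fun i => isOpen_pi_iff.1 (hO' i) _ (hmem i)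
  let t : Finset G := Finset.univ.biUnion fun i => (I i).image Subtype.val
  have ht : ∀ i, ∀ k ∈ I i, (k : G) ∈ t := fun i k hk =>
    Finset.mem_biUnion.2 ⟨i, Finset.mem_univ i, Finset.mem_image_of_mem _ hk⟩
  let U : Set (ι → t → ℝ) := ⋂ i, ⋂ k : I i, {r | r i ⟨k.1, ht i k.1 k.2⟩ ∈ v i k.1}
  have hU : IsOpen U := isOpen_iInter_of_finite fun i => isOpen_iInter_of_finite fun k =>
    (hv i k.1 k.2).1.preimage ((continuous_apply _).comp (continuous_apply i))
  obtain ⟨B, hB, hcB, hBU⟩ := (isBasis_countableBasis (ι → t → ℝ)).exists_subset_of_mem_open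
    (a := sampleValues f t c) (mem_iInter₂.2 fun i k => (hv i k.1 k.2).2) hU
  refine ⟨t, ?_, B, hB, hcB, fun b hb => huO fun i _ => ?_⟩
  · intro g hg
    obtain ⟨i, -, hg⟩ := Finset.mem_biUnion.1 hg
    obtain ⟨k, -, rfl⟩ := Finset.mem_image.1 hg
    exact k.2
  · rw [← e i]
    exact hvO i fun k hk => mem_iInter₂.1 (hBU hb) i ⟨k, hk⟩

variable [TopologicalSpace X] [ContinuousConstSMul G X]

theorem continuous_sampleValues {ι : Type*} (hf : Continuous f) (t : Finset G) :
    Continuous (sampleValues f t : (ι → X) → ι → t → ℝ) :=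
  continuous_pi fun i => continuous_pi fun j =>
    hf.comp ((continuous_apply i).const_smul (j : G))

theorem continuous_toOrbitFactor (hf : Continuous f) : Continuous (toOrbitFactor f K) :=
  continuous_induced_rng.2 (continuous_pi fun k => hf.comp (continuous_const_smul (k : G)))

theorem compactSpace_orbitFactor [CompactSpace X] (hf : Continuous f) :
    CompactSpace (OrbitFactor f K) :=
  toOrbitFactor_surjective.compactSpace (continuous_toOrbitFactor hf)

/-- A countable subgroup whose action on the factor generated by `f` is minimal and for which
the image of a given cube is a cube. -/
theorem exists_countable_subgroup_isMinimal [CompactSpace X] [MulAction.IsMinimal G X] {d : ℕ}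
    (hf : Continuous f) {c : Cube d → X} (hc : c ∈ cubes d G X) :
    ∃ K : Subgroup G, Countable K ∧ MulAction.IsMinimal K (OrbitFactor f K) ∧
      (fun ω => toOrbitFactor f K (c ω)) ∈ cubes d K (OrbitFactor f K) := by
  -- By compactness, finitely many translates of a nonempty open set cover `X`, so one countable set
  -- `s` works for every `y`.
  have hmin : ∀ (t : Finset G) (B : Set (Unit → t → ℝ)), ∃ s : Set G, s.Countable ∧
      (IsOpen B → ∀ z : Unit → X, sampleValues f t z ∈ B →
        ∀ y : X, ∃ g ∈ s, sampleValues f t (fun _ : Unit => g • y) ∈ B) := by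
    intro t B
    by_cases h : IsOpen B ∧ ∃ z : Unit → X, sampleValues f t z ∈ B
    · obtain ⟨hB, z, hz⟩ := h
      have hU : IsOpen {y : X | sampleValues f t (fun _ : Unit => y) ∈ B} :=
        (hB.preimage (continuous_sampleValues hf t)).preimage (continuous_pi fun _ => continuous_id)
      obtain ⟨I, hI⟩ := isCompact_univ.exists_finite_cover_smul G hU ⟨z (), hz⟩
      refine ⟨(fun g => g⁻¹) '' I, (I.countable_toSet).image _, fun _ _ _ y => ?_⟩
      obtain ⟨g, hg, hy⟩ := mem_iUnion₂.1 (hI (mem_univ y))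
      exact ⟨g⁻¹, mem_image_of_mem _ hg, mem_smul_set_iff_inv_smul_mem.1 hy⟩
    · exact ⟨∅, countable_empty, fun hB z hz => absurd ⟨hB, z, hz⟩ h⟩
  have hcube : ∀ (t : Finset G) (B : Set (Cube d → t → ℝ)), ∃ s : Set G, s.Countable ∧
      (IsOpen B → sampleValues f t c ∈ B → ∀ K : Subgroup G, s ⊆ K →
        ∃ k : hostKraGroup d K, ∃ y : X, sampleValues f t (fun ω => k.1 ω • y) ∈ B) := by
    intro t B
    by_cases h : IsOpen B ∧ sampleValues f t c ∈ B
    · obtain ⟨_, hB', h, y, rfl⟩ := mem_closure_iff.1 hc _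
        (h.1.preimage (continuous_sampleValues hf t)) h.2
      obtain ⟨s, hs, hK⟩ := exists_finite_hostKraGroup_support h.2
      refine ⟨s, hs.countable, fun _ _ K hsK => ?_⟩
      obtain ⟨k, hk, e⟩ := hK K hsK
      refine ⟨⟨k, hk⟩, y, ?_⟩
      have e' : (fun ω => k ω • y) = h • constConfig d y :=
        funext fun ω => congrArg (· • y) (e ω)
      change sampleValues f t (fun ω => k ω • y) ∈ B
      rw [e']
      exact hB'
    · exact ⟨∅, countable_empty, fun hB hcB => absurd ⟨hB, hcB⟩ h⟩
  choose S hS hSmin using hmin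
  choose S' hS' hScube using hcube
  obtain ⟨K, hK, hKS⟩ := exists_countable_subgroup
    (fun t => (⋃ B ∈ countableBasis (Unit → t → ℝ), S t B) ∪
      ⋃ B ∈ countableBasis (Cube d → t → ℝ), S' t B)
    (fun t => ((countable_countableBasis _).biUnion fun B _ => hS t B).union
      ((countable_countableBasis _).biUnion fun B _ => hS' t B))
  refine ⟨K, hK, ⟨fun w => ?_⟩, ?_⟩
  · rw [dense_iff_inter_open]
    rintro U hU ⟨w', hw'⟩
    obtain ⟨y, rfl⟩ := toOrbitFactor_surjective w
    obtain ⟨z, rfl⟩ := toOrbitFactor_surjective w'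
    obtain ⟨t, ht, B, hB, hzB, hBU⟩ := exists_sampleValues_basis
      (O := {b : Unit → OrbitFactor f K | b () ∈ U}) (c := fun _ => z)
      (hU.preimage (continuous_apply ())) hw'
    obtain ⟨g, hg, hgB⟩ := hSmin t B (isOpen_of_mem_countableBasis hB) _ hzB y
    have hgK : g ∈ K := hKS t ht (Or.inl (mem_biUnion hB hg))
    refine ⟨_, hBU _ hgB, ⟨g, hgK⟩, ?_⟩
    exact (toOrbitFactor_smul (⟨g, hgK⟩ : K) y).symm
  · rw [cubes, mem_closure_iff]
    intro O hO hcO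
    obtain ⟨t, ht, B, hB, hcB, hBO⟩ := exists_sampleValues_basis hO hcO
    obtain ⟨k, y, hk⟩ := hScube t B (isOpen_of_mem_countableBasis hB) hcB K
      (fun g hg => hKS t ht (Or.inr (mem_biUnion hB hg)))
    refine ⟨_, hBO _ hk, k, toOrbitFactor f K y, ?_⟩
    funext ω
    exact toOrbitFactor_smul (k.1 ω) y

end OrbitFactor

/-! ### Reduction to the second countable case. -/

/-- The face orbit closure of a cube at `x` contains the constant configuration `x^{[d]}`. -/
theorem constConfig_mem_closure_orbit {G X : Type*} [Group G] [TopologicalSpace X]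
    [CompactSpace X] [T2Space X] [MulAction G X] [ContinuousConstSMul G X]
    [MulAction.IsMinimal G X] {d : ℕ} (hd : 1 ≤ d) {x : X} {c : Cube d → X}
    (hc : c ∈ cubesAt d G x) :
    constConfig d x ∈ closure (MulAction.orbit (faceGroup d G) c) := by
  rw [mem_closure_iff]
  intro O hO hxO
  obtain ⟨u, hu, huO⟩ := isOpen_pi_iff'.1 hO _ hxO
  have hV : IsOpen (⋂ ω, u ω) := isOpen_iInter_of_finite fun ω => (hu ω).1
  -- As `f` vanishes at `x` and is `1` off `⋂ ω, u ω`, the bound `f < 1` at every vertex forces a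
  -- configuration into `O`. That bound is an open condition in the factor, read at the coordinate
  -- `1 : K`.
  obtain ⟨f, hf0, hf1, -⟩ := exists_continuous_zero_one_of_isClosed
    (isClosed_singleton (x := x)) hV.isClosed_compl
    (disjoint_singleton_left.2 fun h => h (mem_iInter.2 fun ω => (hu ω).2))
  obtain ⟨K, hK, hmin, hcK⟩ := exists_countable_subgroup_isMinimal f.continuous hc.1
  have := compactSpace_orbitFactor (K := K) f.continuous
  have hlim := constConfig_mem_closure_orbit_of_secondCountable hd
    (x := toOrbitFactor f K x) ⟨hcK, congrArg _ hc.2⟩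
  have hN : IsOpen (⋂ ω : Cube d, {b : Cube d → OrbitFactor f K | (b ω).1 1 < 1}) :=
    isOpen_iInter_of_finite fun ω => isOpen_lt ((continuous_apply (1 : K)).comp
      (continuous_subtype_val.comp (continuous_apply ω))) continuous_const
  obtain ⟨_, hφ, φ, rfl⟩ := mem_closure_iff.1 hlim _ hN (mem_iInter.2 fun ω => by
    change f ((1 : K) • x) < 1
    rw [one_smul, hf0 rfl]
    exact zero_lt_one)
  refine ⟨_, huO ?_, ⟨_, coe_mem_faceGroup φ.2⟩, rfl⟩
  intro ω _
  have h1 : (φ.1 ω • toOrbitFactor f K (c ω)).1 1 < 1 := mem_iInter.1 hφ ω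
  rw [← toOrbitFactor_smul] at h1
  change f ((1 : K) • φ.1 ω • c ω) < 1 at h1
  rw [one_smul] at h1
  by_contra hω
  exact h1.ne (hf1 fun h => hω (mem_iInter.1 h ω))

/-! ### Unique minimal subsystems and forgetting the vertex `0`. -/

theorem closure_orbit_isSubsystem {H : Type*} [Group H] {Z : Type*} [TopologicalSpace Z]
    [MulAction H Z] [ContinuousConstSMul H Z] (a : Z) :
    IsSubsystem H (closure (MulAction.orbit H a)) where
  nonempty := ⟨a, subset_closure (MulAction.mem_orbit_self a)⟩
  isClosed := isClosed_closure
  smul_mem h z hz := map_mem_closure (continuous_const_smul h) hz (by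
    rintro _ ⟨k, rfl⟩
    exact ⟨h * k, mul_smul h k a⟩)

theorem IsSubsystem.closure_orbit_subset {H : Type*} [Group H] {Z : Type*} [TopologicalSpace Z]
    [MulAction H Z] {A : Set Z} (hA : IsSubsystem H A) {z : Z} (hz : z ∈ A) :
    closure (MulAction.orbit H z) ⊆ A := by
  refine closure_minimal ?_ hA.isClosed
  rintro _ ⟨h, rfl⟩
  exact hA.smul_mem h z hz

/-- A point in the orbit closure of each point of a system generates its unique minimal
subsystem. -/
theorem isUniqueMinimalSubsystem_closure_orbit {H : Type*} [Group H] {Z : Type*}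
    [TopologicalSpace Z] [MulAction H Z] [ContinuousConstSMul H Z] {A : Set Z}
    (hA : IsSubsystem H A) {a : Z} (ha : a ∈ A)
    (h : ∀ z ∈ A, a ∈ closure (MulAction.orbit H z)) :
    IsUniqueMinimalSubsystem H A (closure (MulAction.orbit H a)) where
  system := hA
  minimal :=
    { isSubsystem := closure_orbit_isSubsystem a
      subset := hA.closure_orbit_subset ha
      orbit_dense := fun z hz =>
        CubeDynamics.closure_orbit_subset (h z (hA.closure_orbit_subset ha hz)) }
  unique M' hM' := by
    obtain ⟨m, hm⟩ := hM'.isSubsystem.nonempty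
    have haM : a ∈ M' := hM'.isSubsystem.closure_orbit_subset hm (h m (hM'.subset hm))
    exact (hM'.orbit_dense a haM).antisymm (hM'.isSubsystem.closure_orbit_subset haM)

section Star

variable {d : ℕ} {G X : Type*} [Group G] [TopologicalSpace X] [MulAction G X]

theorem continuous_forgetZero : Continuous (forgetZero : (Cube d → X) → StarCube d → X) :=
  continuous_pi fun ω => continuous_apply ω.1

omit [TopologicalSpace X] in
theorem forgetZero_image_orbit (c : Cube d → X) :
    forgetZero '' MulAction.orbit (faceGroup d G) c =
      MulAction.orbit (faceGroup d G) (forgetZero c) := by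
  ext b
  constructor
  · rintro ⟨_, ⟨f, rfl⟩, rfl⟩
    exact ⟨f, rfl⟩
  · rintro ⟨f, rfl⟩
    exact ⟨_, ⟨f, rfl⟩, rfl⟩

instance [ContinuousConstSMul G X] : ContinuousConstSMul (faceGroup d G) (StarCube d → X) :=
  ⟨fun f => continuous_pi fun ω => (continuous_apply ω).const_smul (f.1 ω.1)⟩

variable [CompactSpace X] [T2Space X]

/-- By compactness `forgetZero` is a closed map, so it commutes with closures. -/
theorem faceOrbitClosureStar_eq (x : X) : faceOrbitClosureStar d G x =
    closure (MulAction.orbit (faceGroup d G) (forgetZero (constConfig d x))) := by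
  rw [← forgetZero_image_orbit, faceOrbitClosureStar, faceOrbitClosure]
  exact (continuous_forgetZero.isClosedMap.closure_image_eq_of_continuous
    continuous_forgetZero _).symm

variable [ContinuousConstSMul G X]

omit [CompactSpace X] in
theorem cubesAt_isSubsystem (x : X) : IsSubsystem (faceGroup d G) (cubesAt d G x) where
  nonempty := ⟨constConfig d x, constConfig_mem_cubes x, rfl⟩
  isClosed := isClosed_closure.inter (isClosed_eq (continuous_apply 0) continuous_const)
  smul_mem f _ hc := face_smul_mem_cubesAt f hc

theorem cubesAtStar_isSubsystem (x : X) :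
    IsSubsystem (faceGroup d G) (cubesAtStar d G x) where
  nonempty := (cubesAt_isSubsystem x).nonempty.image _
  isClosed := continuous_forgetZero.isClosedMap _ (cubesAt_isSubsystem x).isClosed
  smul_mem := by
    rintro f _ ⟨c, hc, rfl⟩
    exact ⟨f • c, face_smul_mem_cubesAt f hc, rfl⟩

end Star

end CubeDynamics

theorem mainTheorem3 {G : Type*} [Group G] [TopologicalSpace G] [IsTopologicalGroup G] [T2Space G]
    {X : Type*} [TopologicalSpace X] [CompactSpace X] [T2Space X]
    [MulAction G X] [ContinuousSMul G X] [MulAction.IsMinimal G X]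
    (d : ℕ) (hd : 1 ≤ d) (x : X) :
    CubeDynamics.IsUniqueMinimalSubsystem (CubeDynamics.faceGroup d G)
        (CubeDynamics.cubesAt d G x) (CubeDynamics.faceOrbitClosure d G x) ∧
      CubeDynamics.IsUniqueMinimalSubsystem (CubeDynamics.faceGroup d G)
        (CubeDynamics.cubesAtStar d G x) (CubeDynamics.faceOrbitClosureStar d G x) := by
  have hx : CubeDynamics.constConfig d x ∈ CubeDynamics.cubesAt d G x :=
    ⟨CubeDynamics.constConfig_mem_cubes x, rfl⟩
  refine ⟨CubeDynamics.isUniqueMinimalSubsystem_closure_orbit (CubeDynamics.cubesAt_isSubsystem x)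
    hx fun c hc => CubeDynamics.constConfig_mem_closure_orbit hd hc, ?_⟩
  rw [CubeDynamics.faceOrbitClosureStar_eq]
  refine CubeDynamics.isUniqueMinimalSubsystem_closure_orbit
    (CubeDynamics.cubesAtStar_isSubsystem x) ⟨_, hx, rfl⟩ ?_
  rintro _ ⟨c, hc, rfl⟩
  rw [← CubeDynamics.forgetZero_image_orbit]
  exact image_closure_subset_closure_image CubeDynamics.continuous_forgetZero
    ⟨_, CubeDynamics.constConfig_mem_closure_orbit hd hc, rfl⟩
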